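/- For a finite simple graph $H=(W,F)$ with $W\neq\emptyset$, let its density be $|F|/|W|^2$. There is an absolute constant $K>0$ such that for every constant $\gamma>0$ there is a constant $c=c(\gamma)>0$ with the following property. For every constant $d\in\mathbb{N}$ there is a randomized algorithm whose worst-case running time is bounded by a polynomial in $N$ (the algorithm and the polynomial depending only on $\gamma$ and $d$) and which, given a simple graph $G$ on $N$ vertices and an integer $k$ with $1\le k\le N$, always outputs a set $S$ of exactly $k$ vertices of $G$ such that, if $\delta$ denotes the maximum density of a subgraph of $G$ with exactly $k$ vertices, then with probability at least $1-N^{-d}$ over the coin tosses of the algorithm the subgraph of $G$ induced by $S$ has density at least $c\,\delta^{K/\gamma}N^{-\gamma}$. (Algorithms are programs of a random access machine with unit-cost addition and truncated subtraction and a fair coin-toss instruction; the input is given as $N$, $k$ and the adjacency matrix of $G$.) -/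

import Mathlib

open MeasureTheory

/-! ## Density of graphs and of their `k`-vertex subgraphs -/

namespace DenseSubgraph

/-- The density `|E| / |V|^2` of a (finite) simple graph. -/
noncomputable def density {V : Type*} (G : SimpleGraph V) : ℝ :=
  (G.edgeSet.ncard : ℝ) / (Nat.card V : ℝ) ^ 2

/-- The densest subgraph of `G` on `k` vertices has density `δ`: the value `δ` is the maximum of
the densities of all (not necessarily induced) subgraphs of `G` with exactly `k` vertices. -/
def IsDensestDensity {V : Type*} (G : SimpleGraph V) (k : ℕ) (δ : ℝ) : Prop :=
  IsGreatest {x : ℝ | ∃ H : G.Subgraph, H.verts.ncard = k ∧ density H.coe = x} δ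

end DenseSubgraph

/-! ## A randomized random access machine

Programs are structured (`while`) programs of a random access machine with natural-number
variables and finitely many arrays of unbounded length. The arithmetic operations are addition and
truncated subtraction, each at unit cost. There is no unit-cost multiplication, so that
polynomially many steps on this machine are the same as polynomial time on a Turing machine.
Randomness comes from an instruction that tosses a fair coin. -/

namespace RAM

/-- Machine state: the scalar variables, the contents of the arrays, and the sequence of coin
tosses which have not been consumed yet. -/
structure State where
  var : ℕ → ℕ
  arr : ℕ → ℕ → ℕ
  coins : ℕ → Bool

/-- Expressions. `read a i` is the entry of array number `a` at the index which is the value of `i`;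
`sub` is truncated subtraction. -/
inductive Expr where
  | const (n : ℕ)
  | var (x : ℕ)
  | read (a : ℕ) (i : Expr)
  | add (e₁ e₂ : Expr)
  | sub (e₁ e₂ : Expr)

/-- Value of an expression. -/
def Expr.eval (s : State) : Expr → ℕ
  | .const n => n
  | .var x => s.var x
  | .read a i => s.arr a (i.eval s)
  | .add e₁ e₂ => e₁.eval s + e₂.eval s
  | .sub e₁ e₂ => e₁.eval s - e₂.eval s

/-- Number of elementary operations in the evaluation of an expression. -/
def Expr.cost : Expr → ℕ
  | .const _ => 1
  | .var _ => 1
  | .read _ i => i.cost + 1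
  | .add e₁ e₂ => e₁.cost + e₂.cost + 1
  | .sub e₁ e₂ => e₁.cost + e₂.cost + 1

/-- Programs. `flip x` stores a fair random bit in the variable `x`; the tests of `ite` and `loop`
succeed when the value of the expression is nonzero. -/
inductive Prog where
  | skip
  | assign (x : ℕ) (e : Expr)
  | store (a : ℕ) (i e : Expr)
  | flip (x : ℕ)
  | seq (p q : Prog)
  | ite (e : Expr) (p q : Prog)
  | loop (e : Expr) (p : Prog)

/-- `Exec p s t s'`: started in the state `s`, the program `p` halts after exactly `t` steps in the
state `s'`. -/
inductive Exec : Prog → State → ℕ → State → Prop where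
  | skip (s : State) : Exec .skip s 1 s
  | assign (x : ℕ) (e : Expr) (s : State) :
      Exec (.assign x e) s (e.cost + 1) ⟨Function.update s.var x (e.eval s), s.arr, s.coins⟩
  | store (a : ℕ) (i e : Expr) (s : State) :
      Exec (.store a i e) s (i.cost + e.cost + 1)
        ⟨s.var, Function.update s.arr a (Function.update (s.arr a) (i.eval s) (e.eval s)), s.coins⟩
  | flip (x : ℕ) (s : State) :
      Exec (.flip x) s 1
        ⟨Function.update s.var x (s.coins 0).toNat, s.arr, fun n => s.coins (n + 1)⟩
  | seq {p q : Prog} {s₁ s₂ s₃ : State} {t₁ t₂ : ℕ} (hp : Exec p s₁ t₁ s₂)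
      (hq : Exec q s₂ t₂ s₃) : Exec (.seq p q) s₁ (t₁ + t₂) s₃
  | ite_true {e : Expr} {p q : Prog} {s s' : State} {t : ℕ} (he : e.eval s ≠ 0)
      (hp : Exec p s t s') : Exec (.ite e p q) s (e.cost + 1 + t) s'
  | ite_false {e : Expr} {p q : Prog} {s s' : State} {t : ℕ} (he : e.eval s = 0)
      (hq : Exec q s t s') : Exec (.ite e p q) s (e.cost + 1 + t) s'
  | loop_true {e : Expr} {p : Prog} {s₁ s₂ s₃ : State} {t₁ t₂ : ℕ} (he : e.eval s₁ ≠ 0)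
      (hp : Exec p s₁ t₁ s₂) (hl : Exec (.loop e p) s₂ t₂ s₃) :
      Exec (.loop e p) s₁ (e.cost + 1 + t₁ + t₂) s₃
  | loop_false {e : Expr} {p : Prog} {s : State} (he : e.eval s = 0) :
      Exec (.loop e p) s (e.cost + 1) s

/-- The law of an infinite sequence of independent fair coin tosses. -/
noncomputable def coinMeasure : Measure (ℕ → Bool) :=
  Measure.infinitePi fun _ : ℕ => (PMF.uniformOfFintype Bool).toMeasure

open Classical in
/-- Initial state for a graph `G` on `N` vertices, a number `k` and the coin tosses `ω`: variable `0`
holds `N`, variable `1` holds `k`, array `0` holds the `N × N` adjacency matrix of `G` row by row,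
and everything else is zero. -/
noncomputable def init {N : ℕ} (G : SimpleGraph (Fin N)) (k : ℕ) (ω : ℕ → Bool) : State where
  var := fun x => if x = 0 then N else if x = 1 then k else 0
  arr := fun a m =>
    if a = 0 ∧ ∃ i j : Fin N, G.Adj i j ∧ m = (i : ℕ) * N + (j : ℕ) then 1 else 0
  coins := ω

/-- The vertex set that a state returns: the vertices marked by a nonzero entry of array `1`. -/
def output (N : ℕ) (s : State) : Finset (Fin N) :=
  Finset.univ.filter fun v => s.arr 1 (v : ℕ) ≠ 0

end RAM

/-! ## A language of bounded sums and its compilation to the machine -/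

namespace RAM

/-! The algorithm is deterministic; its success event is the whole space of coin sequences. With `m
= ⌈1/γ⌉` it tries all `m`-tuples of vertices. For a tuple with common neighbourhood `C` it takes the
`k/2` vertices `T` of largest degree into `C`, then the `k/2` vertices `S` of largest degree into
`T`, pads `S ∪ T` to `k` vertices, and keeps the best result.

Let `H` be an optimal `k`-set, `d v` the number of neighbours of `v` in `H`, and suppose that every
candidate has weight (twice its number of edges) at most `P`. Greedy selection gives `k * e(H, C) ≤
9 * P * (|C| + k)` for every common neighbourhood `C` (`mul_sum_degIn_le_weight_candidate`).
Summation over the tuples in `H ^ i`, `1 ≤ i ≤ m`, turns `|C|` into `∑ d ^ i` and `e(H, C)` into `∑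
d ^ (i + 1)`. So the normalized moments `y i = ∑ d ^ i / k ^ (i + 1)` satisfy `y (i + 1) ≤ η * (y i
+ 1)` with `η = 9 * P / k ^ 2`. As `y 1 ≤ N`, a small `η` forces `y (m + 1) ≤ η ^ m * N + 2 * η`,
whereas the power mean inequality on `H` gives `y (m + 1) ≥ (2 * δ) ^ (m + 1)`. Hence `η ≥ δ ^ (m +
1) * N ^ (-1 / m)` (`le_weight_candidate`), which is the claim up to a comparison of exponents.

For the machine, the search is written as a term built from sums over `range N`. Each sum compiles
to one loop, so a fixed term runs in polynomial time, and correctness of the algorithm becomes an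
evaluation of terms. -/

/-- Terms over named variables which denote natural numbers: `size` is the input size `N`,
`read t` is the entry of the input array at index `t`, `sum x t` is the sum of `t` over all values
`< N` of the variable `x`, and `bind x a b` is the value of `b` when `x` has the value of `a`. -/
inductive Term where
  | size
  | const (n : ℕ)
  | var (x : ℕ)
  | add (a b : Term)
  | sub (a b : Term)
  | read (a : Term)
  | sum (x : ℕ) (a : Term)
  | bind (x : ℕ) (a b : Term)

namespace Term

/-- The value of a term for input array `A`, size `N` and variable assignment `ρ`. -/
def eval (A : ℕ → ℕ) (N : ℕ) : Term → (ℕ → ℕ) → ℕ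
  | size, _ => N
  | const n, _ => n
  | var x, ρ => ρ x
  | add a b, ρ => a.eval A N ρ + b.eval A N ρ
  | sub a b, ρ => a.eval A N ρ - b.eval A N ρ
  | read a, ρ => A (a.eval A N ρ)
  | sum x a, ρ => ∑ i ∈ Finset.range N, a.eval A N (Function.update ρ x i)
  | bind x a b, ρ => b.eval A N (Function.update ρ x (a.eval A N ρ))

/-- A strict upper bound for the machine variables that hold the variables of a term. -/
def bound : Term → ℕ
  | size => 1
  | const _ => 1
  | var x => x + 2
  | add a b => max a.bound b.bound
  | sub a b => max a.bound b.bound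
  | read a => a.bound
  | sum x a => max (x + 2) a.bound
  | bind x a b => max (x + 2) (max a.bound b.bound)

/-- A program that puts the value of a term into the machine variable `r`. The variable `x` of the
term is held in the machine variable `x + 1`; variables beyond `r` are scratch space. -/
def compile : Term → ℕ → Prog
  | size, r => .assign r (.var 0)
  | const n, r => .assign r (.const n)
  | var x, r => .assign r (.var (x + 1))
  | add a b, r => .seq (a.compile r) (.seq (b.compile (r + 1))
      (.assign r (.add (.var r) (.var (r + 1)))))
  | sub a b, r => .seq (a.compile r) (.seq (b.compile (r + 1))
      (.assign r (.sub (.var r) (.var (r + 1)))))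
  | read a, r => .seq (a.compile r) (.assign r (.read 0 (.var r)))
  | sum x a, r => .seq (.assign r (.const 0)) (.seq (.assign (r + 1) (.var (x + 1)))
      (.seq (.assign (x + 1) (.const 0))
      (.seq (.loop (.sub (.var 0) (.var (x + 1)))
        (.seq (a.compile (r + 2)) (.seq (.assign r (.add (.var r) (.var (r + 2))))
          (.assign (x + 1) (.add (.var (x + 1)) (.const 1))))))
      (.assign (x + 1) (.var (r + 1))))))
  | bind x a b, r => .seq (a.compile r) (.seq (.assign (r + 1) (.var (x + 1)))
      (.seq (.assign (x + 1) (.var r)) (.seq (b.compile (r + 2))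
      (.seq (.assign (x + 1) (.var (r + 1))) (.assign r (.var (r + 2)))))))

open Polynomial in
/-- A bound for the running time of the compiled program in terms of the input size. -/
noncomputable def time : Term → ℕ[X]
  | size => 2
  | const _ => 2
  | var _ => 2
  | add a b => a.time + b.time + 4
  | sub a b => a.time + b.time + 4
  | read a => a.time + 3
  | sum _ a => X * (a.time + 12) + 12
  | bind _ a b => a.time + b.time + 8

/-! ### Correctness and running time of the compiled terms. -/

theorem one_le_bound (t : Term) : 1 ≤ t.bound := by
  induction t <;> simp only [bound] <;> omega

theorem eval_congr (A : ℕ → ℕ) (N : ℕ) (t : Term) {ρ ρ' : ℕ → ℕ}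
    (h : ∀ x, x + 1 < t.bound → ρ x = ρ' x) : t.eval A N ρ = t.eval A N ρ' := by
  induction t generalizing ρ ρ' with
  | size => rfl
  | const n => rfl
  | var x => exact h x (by simp [bound])
  | add a b iha ihb =>
    simp only [bound, lt_max_iff] at h
    simp only [eval, iha fun x hx => h x (.inl hx), ihb fun x hx => h x (.inr hx)]
  | sub a b iha ihb =>
    simp only [bound, lt_max_iff] at h
    simp only [eval, iha fun x hx => h x (.inl hx), ihb fun x hx => h x (.inr hx)]
  | read a ih => simp only [eval, ih h]
  | sum x a ih =>
    simp only [bound, lt_max_iff] at h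
    refine Finset.sum_congr rfl fun i _ => ih fun y hy => ?_
    rcases eq_or_ne y x with rfl | hne
    · simp
    · simp [hne, h y (.inr hy)]
  | bind x a b iha ihb =>
    simp only [bound, lt_max_iff] at h
    simp only [eval, iha fun y hy => h y (.inr (.inl hy))]
    refine ihb fun y hy => ?_
    rcases eq_or_ne y x with rfl | hne
    · simp
    · simp [hne, h y (.inr (.inr hy))]

end Term

/-- A counting loop with an invariant halts after its last round within the expected time. -/
theorem exists_exec_loop {N x B : ℕ} {p : Prog} (I : ℕ → State → Prop)
    (hI : ∀ i s, I i s → s.var 0 = N ∧ s.var x = i)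
    (hp : ∀ i s, i < N → I i s → ∃ t s', Exec p s t s' ∧ t ≤ B ∧ I (i + 1) s')
    {s : State} (hs : I 0 s) :
    ∃ t s', Exec (.loop (.sub (.var 0) (.var x)) p) s t s' ∧ t ≤ N * (B + 4) + 4 ∧ I N s' := by
  -- Induction on the number `m` of rounds that remain; each test costs 4.
  suffices H : ∀ m i s, i + m = N → I i s →
      ∃ t s', Exec (.loop (.sub (.var 0) (.var x)) p) s t s' ∧ t ≤ m * (B + 4) + 4 ∧ I N s' from
    H N 0 s (by omega) hs
  intro m
  induction m with
  | zero =>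
    intro i s hi h
    obtain rfl : i = N := by omega
    exact ⟨_, s, .loop_false (by simp [Expr.eval, hI _ _ h]), by simp [Expr.cost], h⟩
  | succ m ih =>
    intro i s hi h
    obtain ⟨t₁, s₁, e₁, ht₁, h₁⟩ := hp i s (by omega) h
    obtain ⟨t₂, s₂, e₂, ht₂, h₂⟩ := ih (i + 1) s₁ (by omega) h₁
    refine ⟨_, s₂, .loop_true ?_ e₁ e₂, ?_, h₂⟩
    · simp only [Expr.eval, hI _ _ h]
      omega
    · simp only [Expr.cost]
      rw [Nat.succ_mul]
      omega

/-- The compiled program computes the value of the term, in polynomial time, and does not change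
the machine variables below the one that receives the value. -/
theorem Term.exists_exec_compile (t : Term) (r : ℕ) (hr : t.bound ≤ r) (s : State) :
    ∃ n s', Exec (t.compile r) s n s' ∧ n ≤ t.time.eval (s.var 0) ∧
      s'.var r = t.eval (s.arr 0) (s.var 0) (fun x => s.var (x + 1)) ∧
      (∀ y < r, s'.var y = s.var y) ∧ s'.arr = s.arr ∧ s'.coins = s.coins := by
  induction t generalizing r s with
  | size =>
    exact ⟨_, _, .assign _ _ _, by simp [Expr.cost, time], by simp [Term.eval, Expr.eval],
      fun y hy => by simp [hy.ne], rfl, rfl⟩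
  | const n =>
    exact ⟨_, _, .assign _ _ _, by simp [Expr.cost, time], by simp [Term.eval, Expr.eval],
      fun y hy => by simp [hy.ne], rfl, rfl⟩
  | var x =>
    exact ⟨_, _, .assign _ _ _, by simp [Expr.cost, time], by simp [Term.eval, Expr.eval],
      fun y hy => by simp [hy.ne], rfl, rfl⟩
  | add a b iha ihb =>
    simp only [bound, max_le_iff] at hr
    obtain ⟨n₁, s₁, e₁, hn₁, v₁, f₁, a₁, c₁⟩ := iha r hr.1 s
    obtain ⟨n₂, s₂, e₂, hn₂, v₂, f₂, a₂, c₂⟩ := ihb (r + 1) (by omega) s₁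
    have h0 : s₁.var 0 = s.var 0 := f₁ 0 (by have := a.one_le_bound; omega)
    refine ⟨_, _, .seq e₁ (.seq e₂ (.assign _ _ _)), ?_, ?_, fun y hy => ?_, ?_, ?_⟩
    · simp only [Expr.cost, time, Polynomial.eval_add, Polynomial.eval_ofNat]
      rw [h0] at hn₂
      omega
    · simp only [Expr.eval, Function.update_self, Term.eval, v₂, f₂ r (by omega), v₁, a₁, h0]
      congr 1
      exact Term.eval_congr _ _ _ fun x hx => f₁ _ (by omega)
    · simp [hy.ne, f₂ y (by omega), f₁ y hy]
    · simp [a₂, a₁]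
    · simp [c₂, c₁]
  | sub a b iha ihb =>
    simp only [bound, max_le_iff] at hr
    obtain ⟨n₁, s₁, e₁, hn₁, v₁, f₁, a₁, c₁⟩ := iha r hr.1 s
    obtain ⟨n₂, s₂, e₂, hn₂, v₂, f₂, a₂, c₂⟩ := ihb (r + 1) (by omega) s₁
    have h0 : s₁.var 0 = s.var 0 := f₁ 0 (by have := a.one_le_bound; omega)
    refine ⟨_, _, .seq e₁ (.seq e₂ (.assign _ _ _)), ?_, ?_, fun y hy => ?_, ?_, ?_⟩
    · simp only [Expr.cost, time, Polynomial.eval_add, Polynomial.eval_ofNat]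
      rw [h0] at hn₂
      omega
    · simp only [Expr.eval, Function.update_self, Term.eval, v₂, f₂ r (by omega), v₁, a₁, h0]
      congr 1
      exact Term.eval_congr _ _ _ fun x hx => f₁ _ (by omega)
    · simp [hy.ne, f₂ y (by omega), f₁ y hy]
    · simp [a₂, a₁]
    · simp [c₂, c₁]
  | read a ih =>
    obtain ⟨n₁, s₁, e₁, hn₁, v₁, f₁, a₁, c₁⟩ := ih r hr s
    refine ⟨_, _, .seq e₁ (.assign _ _ _), ?_, ?_, fun y hy => ?_, a₁, c₁⟩
    · simp only [Expr.cost, time, Polynomial.eval_add, Polynomial.eval_ofNat]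
      omega
    · simp [Expr.eval, Term.eval, v₁, a₁]
    · simp [hy.ne, f₁ y hy]
  | bind x a b iha ihb =>
    simp only [bound, max_le_iff] at hr
    obtain ⟨n₁, s₁, e₁, hn₁, v₁, f₁, a₁, c₁⟩ := iha r hr.2.1 s
    have h0 : s₁.var 0 = s.var 0 := f₁ 0 (by have := a.one_le_bound; omega)
    obtain ⟨n₂, s₂, e₂, hn₂, v₂, f₂, a₂, c₂⟩ := ihb (r + 2) (by omega)
      ⟨Function.update (Function.update s₁.var (r + 1) (s₁.var (x + 1))) (x + 1)
        (s₁.var r), s₁.arr, s₁.coins⟩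
    have e₂' : Exec (b.compile (r + 2)) ⟨Function.update (Function.update s₁.var (r + 1)
        (Expr.eval s₁ (.var (x + 1)))) (x + 1) (Expr.eval ⟨Function.update s₁.var (r + 1)
        (Expr.eval s₁ (.var (x + 1))), s₁.arr, s₁.coins⟩ (.var r)), s₁.arr, s₁.coins⟩ n₂ s₂ := by
      simpa [Expr.eval] using e₂
    refine ⟨_, _, .seq e₁ (.seq (.assign _ _ _) (.seq (.assign _ _ _) (.seq e₂' (.seq
      (.assign _ _ _) (.assign _ _ _))))), ?_, ?_, fun y hy => ?_, ?_, ?_⟩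
    · simp only [Expr.cost, time, Polynomial.eval_add, Polynomial.eval_ofNat]
      simp [h0] at hn₂
      omega
    · have hne : r + 2 ≠ x + 1 := by omega
      simp only [Expr.eval, Function.update_self, Term.eval, ne_eq, hne, not_false_eq_true,
        Function.update_of_ne, v₂, a₁]
      rw [Function.update_of_ne (by omega), Function.update_of_ne (by omega), h0]
      refine Term.eval_congr _ _ _ fun y hy => ?_
      rcases eq_or_ne y x with rfl | hyx
      · simp [v₁]
      · have : y ≠ r := by omega
        simp [hyx, this, f₁ (y + 1) (by omega)]
    · simp only [Expr.eval, Function.update_of_ne hy.ne]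
      have hr1 : r ≠ x := by omega
      rcases eq_or_ne y (x + 1) with rfl | hyx
      · simp [f₂ (r + 1) (by omega), hr1, f₁ (x + 1) (by omega)]
      · have : y ≠ r + 1 := by omega
        simp [hyx, f₂ y (by omega), this, f₁ y hy]
    · simp [a₂, a₁]
    · simp [c₂, c₁]
  | sum x a ih =>
    simp only [bound, max_le_iff] at hr
    set N := s.var 0 with hN
    set ρ : ℕ → ℕ := fun y => s.var (y + 1) with hρ
    -- The counter is exempt from the frame condition during the loop; its old value waits in `r +
    -- 1` and is restored afterwards.
    let I : ℕ → State → Prop := fun i s' => s'.var (x + 1) = i ∧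
      s'.var r = ∑ j ∈ Finset.range i, a.eval (s.arr 0) N (Function.update ρ x j) ∧
      s'.var (r + 1) = s.var (x + 1) ∧ (∀ y < r, y ≠ x + 1 → s'.var y = s.var y) ∧
      s'.arr = s.arr ∧ s'.coins = s.coins
    have hI0 : ∀ i s', I i s' → s'.var 0 = N ∧ s'.var (x + 1) = i := fun i s' h =>
      ⟨h.2.2.2.1 0 (by omega) (by omega), h.1⟩
    have hstep : ∀ i s', i < N → I i s' → ∃ t s'', Exec (.seq (a.compile (r + 2))
        (.seq (.assign r (.add (.var r) (.var (r + 2))))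
          (.assign (x + 1) (.add (.var (x + 1)) (.const 1))))) s' t s'' ∧
        t ≤ a.time.eval N + 8 ∧ I (i + 1) s'' := by
      rintro i s' - hi
      have h0 := (hI0 i s' hi).1
      obtain ⟨i1, i2, i3, i4, i5, i6⟩ := hi
      obtain ⟨n₁, s₁, e₁, hn₁, v₁, f₁, a₁, c₁⟩ := ih (r + 2) (by omega) s'
      have hxr : x + 1 ≠ r := by omega
      have hrx : r ≠ x + 1 := by omega
      have hrx' : r ≠ x := by omega
      refine ⟨_, _, .seq e₁ (.seq (.assign _ _ _) (.assign _ _ _)), ?_, ?_, ?_, ?_,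
        fun y hy hyx => ?_, ?_, ?_⟩
      · simp only [Expr.cost]
        rw [h0] at hn₁
        omega
      · simp [Expr.eval, hxr, f₁ (x + 1) (by omega), i1]
      · simp only [Expr.eval, Function.update_of_ne hrx, Function.update_self,
          f₁ r (by omega), i2, v₁, Finset.sum_range_succ, h0, i5]
        congr 1
        refine Term.eval_congr _ _ _ fun y hy => ?_
        rcases eq_or_ne y x with rfl | hyx
        · simp [i1]
        · simp [hyx, hρ, i4 (y + 1) (by omega) (by omega)]
      · simp [hrx', f₁ (r + 1) (by omega), i3]
      · simp [hyx, hy.ne, f₁ y (by omega), i4 y hy hyx]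
      · simp [a₁, i5]
      · simp [c₁, i6]
    set s₀ : State := ⟨Function.update (Function.update (Function.update s.var r 0) (r + 1)
      (Function.update s.var r 0 (x + 1))) (x + 1) 0, s.arr, s.coins⟩ with hs₀
    have hxr : x + 1 ≠ r := by omega
    have hrx : r ≠ x + 1 := by omega
    have hrx' : r ≠ x := by omega
    have hI : I 0 s₀ := by
      refine ⟨by simp [hs₀], by simp [hs₀, hrx], by simp [hs₀, hrx', hxr],
        fun y hy hyx => ?_, rfl, rfl⟩
      have : y ≠ r + 1 := by omega
      simp [hs₀, hyx, hy.ne, this]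
    obtain ⟨n, s', e, hn, j1, j2, j3, j4, j5, j6⟩ := exists_exec_loop I hI0 hstep hI
    refine ⟨_, _, .seq (.assign _ _ _) (.seq (.assign _ _ _) (.seq (.assign _ _ _)
      (.seq (s₂ := s') (t₁ := n) e (.assign _ _ _)))), ?_, ?_, fun y hy => ?_, ?_, ?_⟩
    · simp only [Expr.cost, time, Polynomial.eval_add, Polynomial.eval_mul, Polynomial.eval_X,
        Polynomial.eval_ofNat]
      have : N * (a.time.eval N + 8 + 4) = N * (a.time.eval N + 12) := by ring
      omega
    · simp [hrx, j2, Term.eval, hρ]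
    · rcases eq_or_ne y (x + 1) with rfl | hyx
      · simp [Expr.eval, j3]
      · simp [hyx, j4 y hy hyx]
    · simp [j5]
    · simp [j6]

/-- For every term there is a polynomial time program that outputs the vertices `v` for which the
term is nonzero when its variable `0` is `k`, its variable `1` is `v` and the others are zero. -/
theorem Term.exists_prog_output (t : Term) : ∃ (p : Prog) (T : Polynomial ℕ),
    ∀ (N k : ℕ) (G : SimpleGraph (Fin N)) (ω : ℕ → Bool), ∃ n s, Exec p (init G k ω) n s ∧
      n ≤ T.eval N ∧ output N s = Finset.univ.filter fun v : Fin N =>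
        t.eval ((init G k ω).arr 0) N
          (Function.update (fun x => if x = 0 then k else 0) 1 (v : ℕ)) ≠ 0 := by
  -- The offset keeps `N`, `k` and the vertex counter (machine variables 0, 1, 2) below the scratch
  -- space.
  set r := t.bound + 3 with hr
  refine ⟨.loop (.sub (.var 0) (.var 2)) (.seq (t.compile r) (.seq (.store 1 (.var 2) (.var r))
    (.assign 2 (.add (.var 2) (.const 1))))), .X * (t.time + 11) + 4, fun N k G ω => ?_⟩
  let f : ℕ → ℕ := fun v => t.eval ((init G k ω).arr 0) N
          (Function.update (fun x => if x = 0 then k else 0) 1 v)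
  let I : ℕ → State → Prop := fun i s => s.var 0 = N ∧ s.var 1 = k ∧ s.var 2 = i ∧
    (∀ y < r, 2 < y → s.var y = 0) ∧ s.arr 0 = (init G k ω).arr 0 ∧ ∀ v < i, s.arr 1 v = f v
  have hstep : ∀ i s, i < N → I i s → ∃ n s', Exec (.seq (t.compile r)
      (.seq (.store 1 (.var 2) (.var r)) (.assign 2 (.add (.var 2) (.const 1))))) s n s' ∧
      n ≤ t.time.eval N + 7 ∧ I (i + 1) s' := by
    rintro i s - ⟨h0, h1, h2, h3, h4, h5⟩
    obtain ⟨n₁, s₁, e₁, hn₁, v₁, f₁, a₁, c₁⟩ := t.exists_exec_compile r (by omega) s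
    refine ⟨_, _, .seq e₁ (.seq (.store _ _ _ _) (.assign _ _ _)), ?_, ?_, ?_, ?_,
      fun y hy hy2 => ?_, ?_, fun v hv => ?_⟩
    · simp only [Expr.cost]
      rw [h0] at hn₁
      omega
    · simp [f₁ 0 (by omega), h0]
    · simp [f₁ 1 (by omega), h1]
    · simp [Expr.eval, f₁ 2 (by omega), h2]
    · simp [show y ≠ 2 by omega, f₁ y hy, h3 y hy hy2]
    · simp [a₁, h4]
    · simp only [Expr.eval, Function.update_self, f₁ 2 (by omega), h2, v₁, h0, h4]
      rcases eq_or_ne v i with rfl | hne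
      · simp only [Function.update_self]
        refine Term.eval_congr _ _ _ fun y hy => ?_
        rcases y with _ | _ | y
        · simp [h1]
        · simp [h2]
        · simpa using h3 _ (by omega) (by omega)
      · simp [hne, a₁, h5 v (by omega)]
  obtain ⟨n, s, e, hn, -, -, -, -, -, h⟩ := exists_exec_loop (N := N) (x := 2)
    (B := t.time.eval N + 7) (p := .seq (t.compile r) (.seq (.store 1 (.var 2) (.var r))
    (.assign 2 (.add (.var 2) (.const 1))))) (s := init G k ω) I (fun i s h => ⟨h.1, h.2.2.1⟩) hstep
    ⟨rfl, rfl, rfl, fun y _ hy => by simp [init, show y ≠ 0 by omega, show y ≠ 1 by omega], rfl,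
      by simp⟩
  refine ⟨n, s, e, ?_, Finset.filter_congr fun v _ => by rw [h v v.2]⟩
  simp only [Polynomial.eval_add, Polynomial.eval_mul, Polynomial.eval_X,
    Polynomial.eval_ofNat]
  have : N * (t.time.eval N + 7 + 4) = N * (t.time.eval N + 11) := by ring
  omega

end RAM

/-! ## The vertices of highest score -/

namespace DenseSubgraph

/-- The number of vertices that come before `v` when vertices are ordered by decreasing score. -/
def rank {N : ℕ} (f : Fin N → ℕ) (v : Fin N) : ℕ :=
  (Finset.univ.filter fun u => f v < f u ∨ (f v = f u ∧ u < v)).card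

/-- The `h` vertices of highest score. -/
def topSet {N : ℕ} (h : ℕ) (f : Fin N → ℕ) : Finset (Fin N) :=
  Finset.univ.filter fun v => rank f v < h

theorem rank_lt_rank {N : ℕ} {f : Fin N → ℕ} {u v : Fin N}
    (h : f v < f u ∨ (f v = f u ∧ u < v)) : rank f u < rank f v := by
  refine Finset.card_lt_card (Finset.ssubset_iff_of_subset ?_ |>.2 ⟨u, by simpa using h, by simp⟩)
  intro w
  simp only [Finset.mem_filter, Finset.mem_univ, true_and]
  omega

theorem rank_injective {N : ℕ} (f : Fin N → ℕ) : Function.Injective (rank f) := by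
  intro u v huv
  by_contra hne
  have : (f v < f u ∨ (f v = f u ∧ u < v)) ∨ (f u < f v ∨ (f u = f v ∧ v < u)) := by omega
  rcases this with h | h
  · exact (rank_lt_rank h).ne huv
  · exact (rank_lt_rank h).ne' huv

theorem rank_lt {N : ℕ} (f : Fin N → ℕ) (v : Fin N) : rank f v < N := by
  have := Finset.card_lt_card (Finset.filter_ssubset (s := Finset.univ)
    (p := fun u => f v < f u ∨ (f v = f u ∧ u < v)) |>.2 ⟨v, by simp, by simp⟩)
  simpa [rank] using this

theorem card_topSet {N h : ℕ} (hN : h ≤ N) (f : Fin N → ℕ) : (topSet h f).card = h := by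
  have hinj : Function.Injective fun v => (⟨rank f v, rank_lt f v⟩ : Fin N) := fun u v huv =>
    rank_injective f (by simpa using huv)
  have hb := Finite.injective_iff_bijective.1 hinj
  have : (topSet h f).card = (Finset.univ.filter fun i : Fin N => (i : ℕ) < h).card :=
    Finset.card_bij (fun v _ => ⟨rank f v, rank_lt f v⟩) (by simp [topSet])
      (fun _ _ _ _ huv => hinj huv) fun i hi => by
        obtain ⟨v, hv⟩ := hb.2 i
        exact ⟨v, by simpa [topSet, ← hv] using hi, hv⟩
  rw [this, Fin.card_filter_val_lt]
  omega

theorem le_of_mem_topSet {N h : ℕ} {f : Fin N → ℕ} {u v : Fin N} (hv : v ∈ topSet h f)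
    (hu : u ∉ topSet h f) : f u ≤ f v := by
  by_contra hlt
  have := rank_lt_rank (f := f) (u := u) (v := v) (.inl (by omega))
  simp only [topSet, Finset.mem_filter, Finset.mem_univ, true_and] at hu hv
  omega

/-- The total score of the top vertices in comparison with that of another set of vertices. -/
theorem mul_sum_le_max_mul_sum_topSet {N h : ℕ} (hN : h ≤ N) (f : Fin N → ℕ)
    (Y : Finset (Fin N)) :
    h * ∑ v ∈ Y, f v ≤ max Y.card h * ∑ v ∈ topSet h f, f v := by
  rcases Nat.eq_zero_or_pos h with rfl | hpos
  · simp
  have hcard := card_topSet hN f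
  obtain ⟨w, hw, hmin⟩ := (topSet h f).exists_min_image f (Finset.card_pos.1 (by omega))
  -- With `w` the lowest vertex on top, the truncated excess over `f w` vanishes outside the top
  -- set.
  have h1 : ∑ v ∈ Y, f v ≤ Y.card * f w + ∑ v ∈ topSet h f, (f v - f w) := by
    calc ∑ v ∈ Y, f v ≤ ∑ v ∈ Y, (f w + (f v - f w)) := Finset.sum_le_sum fun v _ => by omega
      _ = Y.card * f w + ∑ v ∈ Y, (f v - f w) := by simp [Finset.sum_add_distrib]
      _ ≤ _ := by
        gcongr 1
        refine Finset.sum_le_sum_of_ne_zero fun v _ hv => ?_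
        by_contra hvt
        exact hv (Nat.sub_eq_zero_of_le (le_of_mem_topSet hw hvt))
  have h2 : ∑ v ∈ topSet h f, f v = h * f w + ∑ v ∈ topSet h f, (f v - f w) := by
    have h3 : h * f w = ∑ v ∈ topSet h f, f w := by rw [Finset.sum_const, hcard, smul_eq_mul]
    rw [h3, ← Finset.sum_add_distrib]
    exact Finset.sum_congr rfl fun v hv => by have := hmin v hv; omega
  rw [h2]
  generalize ∑ v ∈ topSet h f, (f v - f w) = R at *
  calc h * ∑ v ∈ Y, f v ≤ h * (Y.card * f w + R) := by gcongr
    _ = Y.card * (h * f w) + h * R := by ring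
    _ ≤ max Y.card h * (h * f w) + max Y.card h * R := by
      gcongr
      · exact le_max_left _ _
      · exact le_max_right _ _
    _ = _ := by ring

/-- If at most `h` vertices have score one, and the others score zero, then they are all on top. -/
theorem subset_topSet_indicator {N h : ℕ} (Y : Finset (Fin N)) (hY : Y.card ≤ h) :
    Y ⊆ topSet h fun v => if v ∈ Y then 1 else 0 := by
  intro v hv
  simp only [topSet, rank, Finset.mem_filter, Finset.mem_univ, true_and]
  rw [if_pos hv]
  refine lt_of_lt_of_le (Finset.card_lt_card (Finset.ssubset_iff_of_subset ?_ |>.2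
    ⟨v, hv, by simp [hv]⟩)) hY
  intro u
  by_cases hu : u ∈ Y <;> simp [hu]

/-! ## The subgraph that belongs to a sequence of vertices -/

section Candidate

variable {N : ℕ} (G : SimpleGraph (Fin N))

open Classical in
/-- The number of neighbours of `v` in `C`. -/
noncomputable def degIn (C : Finset (Fin N)) (v : Fin N) : ℕ :=
  (C.filter fun u => G.Adj u v).card

/-- Twice the number of edges inside `O`. -/
noncomputable def weight (O : Finset (Fin N)) : ℕ := ∑ v ∈ O, degIn G O v

/-- The best `k` vertices for a set `C`: the `k / 2` vertices of largest degree into `C`, then the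
`k / 2` vertices of largest degree into these, then arbitrary vertices. -/
noncomputable def candidate (k : ℕ) (C : Finset (Fin N)) : Finset (Fin N) :=
  topSet k fun v => if v ∈ topSet (k / 2) (degIn G (topSet (k / 2) (degIn G C))) ∪
    topSet (k / 2) (degIn G C) then 1 else 0

open Classical in
/-- The common neighbourhood of the first `m` vertices with numbers `x 0`, `x 1`, .... -/
noncomputable def commonNbhd (m : ℕ) (x : ℕ → ℕ) : Finset (Fin N) :=
  Finset.univ.filter fun v => ∀ j < m, ∃ u : Fin N, (u : ℕ) = x j ∧ G.Adj u v

variable {G}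

theorem degIn_eq_sum (C : Finset (Fin N)) (v : Fin N) [DecidableRel G.Adj] :
    degIn G C v = ∑ u ∈ C, if G.Adj u v then 1 else 0 := by
  classical
  simp only [degIn, Finset.card_filter]
  exact Finset.sum_congr rfl fun u _ => by congr

theorem sum_degIn_comm (S C : Finset (Fin N)) :
    ∑ v ∈ S, degIn G C v = ∑ u ∈ C, degIn G S u := by
  classical
  simp only [degIn_eq_sum]
  rw [Finset.sum_comm]
  simp only [G.adj_comm]

open Classical in
theorem degIn_mono {C D : Finset (Fin N)} (h : C ⊆ D) (v : Fin N) : degIn G C v ≤ degIn G D v :=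
  Finset.card_le_card (Finset.filter_subset_filter _ h)

open Classical in
theorem degIn_le_card (C : Finset (Fin N)) (v : Fin N) : degIn G C v ≤ C.card :=
  Finset.card_filter_le _ _

/-- `weight` counts ordered pairs, so `S` and `T` may overlap without loss. -/
theorem sum_degIn_le_weight {S T O : Finset (Fin N)} (hS : S ⊆ O) (hT : T ⊆ O) :
    ∑ v ∈ S, degIn G T v ≤ weight G O :=
  (Finset.sum_le_sum_of_subset hS).trans (Finset.sum_le_sum fun v _ => degIn_mono hT v)

theorem card_candidate {k : ℕ} (hk : k ≤ N) (C : Finset (Fin N)) :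
    (candidate G k C).card = k := card_topSet hk _

/-- The candidate for `C` is good if some set of `k` vertices has many edges to `C`. -/
theorem mul_sum_degIn_le_weight_candidate {k : ℕ} (hk2 : 2 ≤ k) (hk : k ≤ N)
    (C H : Finset (Fin N)) (hH : H.card = k) :
    k * ∑ v ∈ H, degIn G C v ≤ 9 * weight G (candidate G k C) * (C.card + k) := by
  set h := k / 2 with hh
  set T := topSet h (degIn G C) with hT
  set S := topSet h (degIn G T) with hS
  set P := weight G (candidate G k C) with hP
  have hsub : S ∪ T ⊆ candidate G k C := by
    refine subset_topSet_indicator (S ∪ T) ((Finset.card_union_le _ _).trans ?_)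
    rw [hS, hT, card_topSet (by omega), card_topSet (by omega)]
    omega
  have hST : ∑ v ∈ S, degIn G T v ≤ P := sum_degIn_le_weight
    (Finset.subset_union_left.trans hsub) (Finset.subset_union_right.trans hsub)
  have h1 := mul_sum_le_max_mul_sum_topSet (h := h) (by omega) (degIn G C) H
  have h2 := mul_sum_le_max_mul_sum_topSet (h := h) (by omega) (degIn G T) C
  rw [hH, max_eq_left (by omega), ← hT] at h1
  rw [← sum_degIn_comm, ← hS] at h2
  have hmax : max C.card h ≤ C.card + k :=
    max_le (Nat.le_add_right _ _) ((Nat.div_le_self k 2).trans (Nat.le_add_left _ _))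
  -- The worst case is `k = 3`, `h = 1`. The bound is used twice, whence the factor 9.
  have h3 : k ≤ 3 * h := by omega
  refine le_of_mul_le_mul_left ?_ (show 0 < k by omega)
  generalize ∑ v ∈ H, degIn G C v = E at *
  generalize ∑ v ∈ T, degIn G C v = F at *
  calc k * (k * E) ≤ (3 * h) * (3 * h * E) := by gcongr
    _ = 9 * h * (h * E) := by ring
    _ ≤ 9 * h * (k * F) := by gcongr
    _ = 9 * k * (h * F) := by ring
    _ ≤ 9 * k * ((C.card + k) * P) :=
      Nat.mul_le_mul_left _ (h2.trans (Nat.mul_le_mul hmax hST))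
    _ = _ := by ring

/-! ### Moments of the degrees into the dense set. -/

open Classical in
-- Double counting: `v` is a common neighbour of exactly `degIn G H v ^ i` tuples from `H`.
theorem sum_piFinset_commonNbhd (H : Finset (Fin N)) (i : ℕ) (g : Fin N → ℕ) :
    ∑ x ∈ Fintype.piFinset fun _ : Fin i => H,
      ∑ v ∈ Finset.univ.filter fun v => ∀ j, G.Adj (x j) v, g v = ∑ v, degIn G H v ^ i * g v := by
  simp only [Finset.sum_filter]
  rw [Finset.sum_comm]
  refine Finset.sum_congr rfl fun v _ => ?_
  rw [← Finset.sum_filter, Finset.sum_const, smul_eq_mul]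
  congr 1
  have : (Fintype.piFinset fun _ : Fin i => H).filter (fun x => ∀ j, G.Adj (x j) v) =
      Fintype.piFinset fun _ : Fin i => H.filter fun u => G.Adj u v := by
    ext x
    simp only [Finset.mem_filter, Fintype.mem_piFinset, forall_and]
  rw [this, Fintype.card_piFinset]
  simp [degIn]

/-- Shorter sequences of vertices can be prolonged without changing the common neighbourhood. -/
theorem exists_commonNbhd_eq {i m : ℕ} (hi : 1 ≤ i) (him : i ≤ m) (x : Fin i → Fin N) :
    ∃ y : ℕ → ℕ, (∀ j, y j < N) ∧ ∀ v, v ∈ commonNbhd G m y ↔ ∀ j, G.Adj (x j) v := by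
  -- The last entry is repeated, which requires a nonempty tuple.
  refine ⟨fun j => x ⟨min j (i - 1), by omega⟩, fun j => Fin.is_lt _, fun v => ?_⟩
  simp only [commonNbhd, Finset.mem_filter, Finset.mem_univ, true_and]
  constructor
  · intro h j
    obtain ⟨u, hu, huv⟩ := h j (by omega)
    obtain rfl : u = x j := by
      rw [Fin.ext hu]
      congr 2
      omega
    exact huv
  · exact fun h j _ => ⟨_, rfl, h _⟩

/-- Comparison of the moments of the degrees into `H`, if all candidates have few edges. -/
theorem mul_sum_degIn_pow_succ_le {k m i P : ℕ} (hk2 : 2 ≤ k) (hk : k ≤ N) (hi : 1 ≤ i)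
    (him : i ≤ m)
    (hP : ∀ x : ℕ → ℕ, (∀ j, x j < N) → weight G (candidate G k (commonNbhd G m x)) ≤ P)
    (H : Finset (Fin N)) (hH : H.card = k) :
    k * ∑ v, degIn G H v ^ (i + 1) ≤ 9 * P * (∑ v, degIn G H v ^ i + k ^ (i + 1)) := by
  classical
  have h1 := sum_piFinset_commonNbhd (G := G) H i (degIn G H)
  have h2 := sum_piFinset_commonNbhd (G := G) H i 1
  simp only [Pi.one_apply, mul_one, Finset.sum_const, smul_eq_mul, ← pow_succ] at h1 h2
  -- Spread over the `k ^ i` tuples, so that the inequality can be checked tuple by tuple.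
  have h3 : k ^ (i + 1) = ∑ x ∈ Fintype.piFinset fun _ : Fin i => H, k := by
    simp [Fintype.card_piFinset, hH, pow_succ]
  rw [← h1, ← h2, h3, ← Finset.sum_add_distrib, Finset.mul_sum, Finset.mul_sum]
  refine Finset.sum_le_sum fun x _ => ?_
  obtain ⟨y, hyN, hy⟩ := exists_commonNbhd_eq (G := G) hi him x
  have hy' : Finset.univ.filter (fun v => ∀ j, G.Adj (x j) v) = commonNbhd G m y := by
    ext v
    simp [hy]
  rw [hy', sum_degIn_comm]
  refine (mul_sum_degIn_le_weight_candidate hk2 hk _ H hH).trans ?_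
  gcongr
  exact hP y hyN

/-- A sequence with `y (i + 1) ≤ η * (y i + 1)` for a small `η` becomes small. -/
theorem le_of_le_mul_add_one {y : ℕ → ℝ} {η Y : ℝ} {m : ℕ} (hη : 0 ≤ η) (hη2 : η ≤ 1 / 2)
    (h1 : y 1 ≤ Y) (h : ∀ i, 1 ≤ i → i ≤ m → y (i + 1) ≤ η * (y i + 1)) :
    y (m + 1) ≤ η ^ m * Y + 2 * η := by
  induction m with
  | zero => simp only [zero_add, pow_zero, one_mul]; linarith
  | succ m ih =>
    calc y (m + 1 + 1) ≤ η * (y (m + 1) + 1) := h _ (by omega) le_rfl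
      _ ≤ η * (η ^ m * Y + 2 * η + 1) := by
        gcongr
        exact ih fun i hi him => h i hi (by omega)
      _ = η ^ (m + 1) * Y + 2 * η * η + η := by ring
      _ ≤ η ^ (m + 1) * Y + 2 * (1 / 2) * η + η := by gcongr
      _ = _ := by ring

/-- One of the candidates has almost as many edges as the densest subgraph. -/
theorem le_weight_candidate {k m P : ℕ} (hm : 1 ≤ m) (hk2 : 2 ≤ k) (hk : k ≤ N)
    (hP : ∀ x : ℕ → ℕ, (∀ j, x j < N) → weight G (candidate G k (commonNbhd G m x)) ≤ P)
    (H : Finset (Fin N)) (hH : H.card = k) {δ : ℝ} (hδ : 0 ≤ δ) (hδ1 : δ ≤ 1 / 2)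
    (hδH : 2 * δ * k ^ 2 ≤ weight G H) :
    δ ^ (m + 1) * (N : ℝ) ^ (-(1 / m : ℝ)) * k ^ 2 ≤ 9 * P := by
  have hk0 : (0 : ℝ) < k := by exact_mod_cast (by omega : 0 < k)
  have hN0 : (1 : ℝ) ≤ N := by exact_mod_cast (by omega : 1 ≤ N)
  rcases hδ.eq_or_lt with rfl | hδ0
  · simp
  set η : ℝ := 9 * P / k ^ 2 with hη
  rw [← le_div_iff₀ (by positivity), ← hη]
  by_contra! hlt
  have hη0 : 0 ≤ η := by positivity
  have hNle : (N : ℝ) ^ (-(1 / m : ℝ)) ≤ 1 :=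
    Real.rpow_le_one_of_one_le_of_nonpos hN0 (by simp)
  have hN' : 0 ≤ (N : ℝ) ^ (-(1 / m : ℝ)) := by positivity
  have hδ1' : δ ^ (m + 1) ≤ δ := pow_le_of_le_one hδ (by linarith) (by omega)
  have hηδ : η ≤ δ ^ (m + 1) := hlt.le.trans (mul_le_of_le_one_right (by positivity) hNle)
  -- The scaling under which the moment inequality becomes `y (i + 1) ≤ η * (y i + 1)`.
  let y : ℕ → ℝ := fun i => (∑ v, (degIn G H v : ℝ) ^ i) / k ^ (i + 1)
  have hy1 : y 1 ≤ N := by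
    have : ∀ v, (degIn G H v : ℝ) ≤ k := fun v => by
      rw [← hH]
      exact_mod_cast degIn_le_card H v
    have h2 : ∑ v, (degIn G H v : ℝ) ≤ N * k := by
      simpa using Finset.sum_le_sum fun v (_ : v ∈ Finset.univ) => this v
    simp only [y, pow_one]
    rw [div_le_iff₀ (by positivity)]
    have hk1 : (1 : ℝ) ≤ k := by exact_mod_cast (by omega : 1 ≤ k)
    exact h2.trans (mul_le_mul_of_nonneg_left (le_self_pow₀ hk1 (by norm_num)) (by linarith))
  have hstep : ∀ i, 1 ≤ i → i ≤ m → y (i + 1) ≤ η * (y i + 1) := by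
    intro i hi him
    have h := mul_sum_degIn_pow_succ_le (G := G) hk2 hk hi him hP H hH
    have h' : (k : ℝ) * ∑ v, (degIn G H v : ℝ) ^ (i + 1) ≤
        9 * P * (∑ v, (degIn G H v : ℝ) ^ i + k ^ (i + 1)) := by exact_mod_cast h
    have e1 : y (i + 1) = (k * ∑ v, (degIn G H v : ℝ) ^ (i + 1)) / k ^ (i + 3) := by
      simp only [y]
      field_simp
      ring
    have e2 : η * (y i + 1) = 9 * P * (∑ v, (degIn G H v : ℝ) ^ i + k ^ (i + 1)) / k ^ (i + 3) := by
      simp only [y, hη]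
      field_simp
      ring
    rw [e1, e2]
    gcongr
  -- Power mean inequality over `H`, where the average degree is at least `2 * δ * k`.
  have hlast : (2 * δ) ^ (m + 1) ≤ y (m + 1) := by
    have h1 : (∑ v ∈ H, (degIn G H v : ℝ)) ^ (m + 1) / (H.card : ℝ) ^ m ≤
        ∑ v ∈ H, (degIn G H v : ℝ) ^ (m + 1) :=
      pow_sum_div_card_le_sum_pow (fun _ _ => by positivity) m
    have h2 : ∑ v ∈ H, (degIn G H v : ℝ) ^ (m + 1) ≤ ∑ v, (degIn G H v : ℝ) ^ (m + 1) :=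
      Finset.sum_le_sum_of_subset_of_nonneg (Finset.subset_univ _) fun _ _ _ => by positivity
    have h3 : (2 * δ * k ^ 2) ^ (m + 1) ≤ (∑ v ∈ H, (degIn G H v : ℝ)) ^ (m + 1) := by
      gcongr
      simpa [weight] using hδH
    simp only [y]
    rw [le_div_iff₀ (by positivity)]
    refine le_trans ?_ (h1.trans h2)
    rw [le_div_iff₀ (by rw [hH]; positivity), hH]
    refine le_trans (le_of_eq ?_) h3
    ring
  have hfin := le_of_le_mul_add_one hη0 (by linarith) hy1 hstep
  have hηm : η ^ m * N ≤ δ ^ (m + 1) := by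
    calc η ^ m * N ≤ (δ ^ (m + 1) * (N : ℝ) ^ (-(1 / m : ℝ))) ^ m * N := by gcongr
      _ = (δ ^ (m + 1)) ^ m := by
        rw [mul_pow, ← Real.rpow_natCast ((N : ℝ) ^ _), ← Real.rpow_mul (by linarith)]
        have : -(1 / (m : ℝ)) * m = -1 := by
          have : (m : ℝ) ≠ 0 := by positivity
          field_simp
        rw [this, Real.rpow_neg_one, mul_assoc, inv_mul_cancel₀ (by linarith), mul_one]
      _ ≤ δ ^ (m + 1) := pow_le_of_le_one (by positivity)
        (pow_le_one₀ hδ (by linarith)) (by omega)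
  -- The upper bound `η ^ m * N + 2 * η` is at most `3 * δ ^ (m + 1)`; the factor 4 beats it.
  have h4 : 4 * δ ^ (m + 1) ≤ (2 * δ) ^ (m + 1) := by
    rw [mul_pow]
    gcongr
    calc (4 : ℝ) = 2 ^ 2 := by norm_num
      _ ≤ 2 ^ (m + 1) := pow_le_pow_right₀ (by norm_num) (by omega)
  have : 0 < δ ^ (m + 1) := by positivity
  linarith

/-! ## Densities -/

theorem weight_eq_two_mul_ncard_edgeSet_induce (S : Finset (Fin N)) :
    weight G S = 2 * (G.induce (S : Set (Fin N))).edgeSet.ncard := by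
  classical
  rw [Set.ncard_eq_toFinset_card', Set.toFinset_card, ← SimpleGraph.edgeFinset_card,
    ← SimpleGraph.sum_degrees_eq_twice_card_edges, weight, ← Finset.sum_coe_sort]
  refine Finset.sum_congr rfl fun v _ => ?_
  rw [SimpleGraph.degree, degIn, ← Finset.card_map (Function.Embedding.subtype _)]
  congr 1
  ext u
  simp [G.adj_comm, and_comm]

theorem two_mul_ncard_edgeSet_le_weight (H : G.Subgraph) (S : Finset (Fin N))
    (hS : (S : Set (Fin N)) = H.verts) : 2 * H.coe.edgeSet.ncard ≤ weight G S := by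
  rw [weight_eq_two_mul_ncard_edgeSet_induce, hS]
  refine Nat.mul_le_mul_left 2 ?_
  have hle : H.coe ≤ G.induce H.verts := fun u v h => H.adj_sub h
  exact Set.ncard_le_ncard (SimpleGraph.edgeSet_mono hle) (Set.toFinite _)

end Candidate

end DenseSubgraph

/-! ## The algorithm as a term -/

namespace RAM

namespace Term

/-- Negation; nonzero values count as true. -/
def neg (a : Term) : Term := sub (const 1) a

/-- Conjunction. -/
def and (a b : Term) : Term := neg (add (neg a) (neg b))

/-- Disjunction. -/
def or (a b : Term) : Term := neg (neg (add a b))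

/-- Strict comparison. -/
def lt (a b : Term) : Term := neg (neg (sub b a))

/-- Equality. -/
def eq (a b : Term) : Term := neg (add (sub a b) (sub b a))

section Logic

variable (A : ℕ → ℕ) (N : ℕ) (a b : Term) (ρ : ℕ → ℕ)

theorem eval_and :
    (and a b).eval A N ρ = if a.eval A N ρ ≠ 0 ∧ b.eval A N ρ ≠ 0 then 1 else 0 := by
  simp only [and, neg, eval]
  split_ifs <;> omega

theorem eval_or :
    (or a b).eval A N ρ = if a.eval A N ρ ≠ 0 ∨ b.eval A N ρ ≠ 0 then 1 else 0 := by
  simp only [or, neg, eval]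
  split_ifs <;> omega

theorem eval_lt : (lt a b).eval A N ρ = if a.eval A N ρ < b.eval A N ρ then 1 else 0 := by
  simp only [lt, neg, eval]
  split_ifs <;> omega

theorem eval_eq : (eq a b).eval A N ρ = if a.eval A N ρ = b.eval A N ρ then 1 else 0 := by
  simp only [eq, neg, eval]
  split_ifs <;> omega

end Logic

/-- Membership of the value of the variable `a` in the set of the `h` numbers with highest score
`t`, where `t` is a term in the variable `a`, and the variable `b` is not used. -/
def top (h t : Term) (a b : ℕ) : Term :=
  lt (sum b (or (lt t (bind a (var b) t))
    (and (eq t (bind a (var b) t)) (lt (var b) (var a))))) h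

/-- The inner sum computes `rank`. Only the value of `t` must be independent of `b`, so `t` may bind
`b` itself; nested uses of variable 3 rely on this. -/
theorem eval_top (A : ℕ → ℕ) {N : ℕ} (h t : Term) {a b : ℕ} (hab : a ≠ b) (ρ : ℕ → ℕ)
    (f : Fin N → ℕ) (hf : ∀ ρ' : ℕ → ℕ, (∀ y, y ≠ a → y ≠ b → ρ' y = ρ y) →
      ∀ u : Fin N, ρ' a = u → t.eval A N ρ' = f u) (v : Fin N) (hv : ρ a = v) :
    (top h t a b).eval A N ρ = if v ∈ DenseSubgraph.topSet (h.eval A N ρ) f then 1 else 0 := by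
  have h1 : ∀ (i : ℕ) (u : Fin N),
      t.eval A N (Function.update (Function.update ρ b i) a u) = f u := fun i u =>
    hf _ (fun y hya hyb => by simp [hya, hyb]) u (by simp)
  have h2 : ∀ i : ℕ, t.eval A N (Function.update ρ b i) = f v := fun i =>
    hf _ (fun y hya hyb => by simp [hyb]) v (by simp [hab, hv])
  have h3 : (sum b (or (lt t (bind a (var b) t))
      (and (eq t (bind a (var b) t)) (lt (var b) (var a))))).eval A N ρ =
      DenseSubgraph.rank f v := by
    rw [DenseSubgraph.rank, Finset.card_filter]
    simp only [eval, eval_or, eval_lt, eval_and, eval_eq, Function.update_self,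
      Function.update_of_ne hab, h1, h2, hv, Finset.sum_range]
    refine Finset.sum_congr rfl fun u _ => if_congr ?_ rfl rfl
    simp
  rw [top, eval_lt, h3]
  refine if_congr ?_ rfl rfl
  simp [DenseSubgraph.topSet]

/-! ### Maximization over tuples by bounded sums. -/

/-- The number `x < N` for which the term `t` has the highest value; `3` and `4` are not used in
`t`. -/
def argmax (x : ℕ) (t : Term) : Term :=
  sum x (sum 4 (and (lt (var 4) (var x)) (top (const 1) t x 3)))

/-- Only the top-ranked `x = z` contributes to the outer sum, and the inner sum then counts the
numbers below `z`. The maximizer `z` is fixed before `ρ`, so it serves all assignments with the same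
scores. -/
theorem exists_eval_argmax (A : ℕ → ℕ) {N : ℕ} (hN : 1 ≤ N) (t : Term) {x : ℕ} (hx3 : x ≠ 3)
    (hx4 : x ≠ 4) (f : Fin N → ℕ) :
    ∃ z : Fin N, (∀ i, f i ≤ f z) ∧ ∀ ρ : ℕ → ℕ, (∀ ρ' : ℕ → ℕ,
      (∀ y, y ≠ x → y ≠ 3 → y ≠ 4 → ρ' y = ρ y) → ∀ u : Fin N, ρ' x = u → t.eval A N ρ' = f u) →
      (argmax x t).eval A N ρ = z := by
  obtain ⟨z, hz⟩ := Finset.card_eq_one.1 (DenseSubgraph.card_topSet hN f)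
  refine ⟨z, fun i => ?_, fun ρ hf => ?_⟩
  · rcases eq_or_ne i z with rfl | hne
    · exact le_rfl
    · exact DenseSubgraph.le_of_mem_topSet (f := f) (h := 1) (by simp [hz]) (by simp [hz, hne])
  · have h1 : ∀ v w : Fin N, (top (const 1) t x 3).eval A N
        (Function.update (Function.update ρ x v) 4 w) = if v = z then 1 else 0 := by
      intro v w
      rw [eval_top A _ _ hx3 _ f (fun ρ' hρ' => hf ρ' fun y hyx hy3 hy4 => ?_) v (by simp [hx4])]
      · simp only [eval, hz, Finset.mem_singleton]
      · simp [hρ' y hyx hy3, hyx, hy4]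
    simp only [argmax, eval, Finset.sum_range, eval_and, eval_lt, h1, Function.update_self,
      Function.update_of_ne hx4]
    rw [Finset.sum_eq_single z]
    · rw [← Finset.card_filter]
      have : (Finset.univ.filter fun i : Fin N => (i : ℕ) < z).card = z := by
        rw [Fin.card_filter_val_lt, min_eq_right z.2.le]
      simpa using this
    · intro v _ hv
      simp [hv]
    · simp

/-- The value of `t` after the variables `10`, ..., `10 + m - 1` have been chosen so that the term
`w` becomes as large as possible. -/
def best (w : Term) : ℕ → Term → Term
  | 0, t => t
  | m + 1, t => bind (10 + m) (argmax (10 + m) (best w m w)) (best w m t)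

/-- Replacement of the values of the variables `10`, `11`, .... -/
def setTuple (ρ x : ℕ → ℕ) (n : ℕ) : ℕ := if n < 10 then ρ n else x (n - 10)

theorem setTuple_self (ρ : ℕ → ℕ) : setTuple ρ (fun j => ρ (10 + j)) = ρ := by
  funext n
  simp only [setTuple]
  split_ifs with h
  · rfl
  · congr 1
    omega

/-- Coordinate `m` is chosen to maximize the optimum over the earlier coordinates, so iterated
maximization is joint maximization. The function `c` completes a tuple whose entries from `m` on are
prescribed. -/
theorem exists_eval_best (A : ℕ → ℕ) {N : ℕ} (hN : 1 ≤ N) (k : ℕ) (w : Term)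
    (W : (ℕ → ℕ) → ℕ) (hw : ∀ ρ, ρ 0 = k → w.eval A N ρ = W fun j => ρ (10 + j)) (m : ℕ) :
    ∃ c : (ℕ → ℕ) → ℕ → ℕ,
      (∀ t ρ, ρ 0 = k → (best w m t).eval A N ρ =
        t.eval A N (setTuple ρ (c fun j => ρ (10 + j)))) ∧
      ∀ x y, (∀ j < m, y j < N) → (∀ j, m ≤ j → y j = x j) → W y ≤ W (c x) := by
  induction m with
  | zero =>
    refine ⟨fun x => x, fun t ρ _ => by rw [setTuple_self, best], fun x y _ h => ?_⟩
    rw [show y = x from funext fun j => h j (Nat.zero_le j)]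
  | succ m ih =>
    obtain ⟨c, hc, hopt⟩ := ih
    have hbest : ∀ ρ, ρ 0 = k → (best w m w).eval A N ρ = W (c fun j => ρ (10 + j)) := by
      intro ρ hρ
      rw [hc _ _ hρ, hw _ (by simpa [setTuple] using hρ)]
      congr 1
      funext j
      simp [setTuple]
    have key : ∀ x, ∃ z : Fin N,
        (∀ i : Fin N, W (c (Function.update x m i)) ≤ W (c (Function.update x m z))) ∧
        (∀ ρ : ℕ → ℕ, ρ 0 = k → (fun j => ρ (10 + j)) = x →
        (argmax (10 + m) (best w m w)).eval A N ρ = z) := by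
      intro x
      obtain ⟨z, hz, hzρ⟩ := exists_eval_argmax A hN (best w m w) (x := 10 + m) (by omega)
        (by omega) fun i => W (c (Function.update x m i))
      refine ⟨z, hz, fun ρ hk hx => hzρ ρ fun ρ' hρ' u hu => ?_⟩
      rw [hbest _ (by rw [hρ' 0 (by omega) (by omega) (by omega), hk])]
      congr 2
      funext j
      rcases eq_or_ne j m with rfl | hne
      · simp [hu]
      · rw [hρ' _ (by omega) (by omega) (by omega), Function.update_of_ne hne, ← hx]
    choose z hzopt hz using key
    refine ⟨fun x => c (Function.update x m (z x)), fun t ρ hρ => ?_, fun x y hy hyx => ?_⟩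
    · have h1 : (fun j => Function.update ρ (10 + m) (z fun j => ρ (10 + j) : ℕ) (10 + j)) =
          Function.update (fun j => ρ (10 + j)) m (z fun j => ρ (10 + j) : ℕ) := by
        funext j
        rcases eq_or_ne j m with rfl | hne
        · simp
        · simp [hne]
      rw [best, eval, hz _ ρ hρ rfl, hc _ _ (by rwa [Function.update_of_ne (by omega)]), h1]
      congr 1
      funext n
      simp only [setTuple]
      split_ifs with hn
      · rw [Function.update_of_ne (by omega)]
      · rfl
    · refine le_trans ?_ (hzopt x ⟨y m, hy m (by omega)⟩)
      refine hopt _ y (fun j hj => hy j (by omega)) fun j hj => ?_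
      rcases eq_or_ne j m with rfl | hne
      · simp
      · rw [Function.update_of_ne hne]
        exact hyx j (by omega)

/-! ### Terms for the graph operations: variable 0 is `k`, 1 the vertex, 2 to 4 are bound, 10
onwards hold the tuple. -/

/-- The entry of the adjacency matrix in row `x` and column `y`. -/
def adj (x y : ℕ) : Term := read (add (sum 2 (var x)) (var y))

/-- Half of the variable `0`. -/
def half : Term := sum 3 (lt (add (var 3) (add (var 3) (const 1))) (var 0))

/-- Membership of the variable `1` in the common neighbourhood of the variables `10`, `11`, .... -/
def commonNbhd : ℕ → Term
  | 0 => const 1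
  | m + 1 => and (commonNbhd m) (adj (10 + m) 1)

/-- The number of neighbours of the variable `1` in the set that is given by `t`. -/
def degIn (t : Term) : Term := sum 3 (and (bind 1 (var 3) t) (adj 3 1))

/-- Membership of the variable `1` in the candidate for the set that is given by `t`. -/
def candidate (t : Term) : Term :=
  top (var 0) (or (top half (degIn (top half (degIn t) 1 3)) 1 3) (top half (degIn t) 1 3)) 1 3

/-- Twice the number of edges in the set that is given by `t`. -/
def weight (t : Term) : Term := sum 1 (sum 4 (and t (and (bind 1 (var 4) t) (adj 4 1))))

/-- If the variable `0` is `k`, then the term `t` in the variable `1` has the values of `f`, where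
`f` may depend on the variables `10`, `11`, .... -/
def Computes (A : ℕ → ℕ) {N : ℕ} (k : ℕ) (t : Term) (f : (ℕ → ℕ) → Fin N → ℕ) : Prop :=
  ∀ (ρ : ℕ → ℕ) (v : Fin N), ρ 0 = k → ρ 1 = v → t.eval A N ρ = f (fun j => ρ (10 + j)) v

/-- The term `t` is the indicator of the set `S`. -/
def ComputesSet (A : ℕ → ℕ) {N : ℕ} (k : ℕ) (t : Term) (S : (ℕ → ℕ) → Finset (Fin N)) : Prop :=
  Computes A k t fun x v => if v ∈ S x then 1 else 0

theorem update_ten_add (ρ : ℕ → ℕ) {n : ℕ} (hn : n < 10) (i j : ℕ) :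
    Function.update ρ n i (10 + j) = ρ (10 + j) :=
  Function.update_of_ne (by omega) _ _

section Computes

variable {A : ℕ → ℕ} {N k : ℕ}

theorem ComputesSet.eval_ne_zero {t : Term} {S : (ℕ → ℕ) → Finset (Fin N)}
    (ht : ComputesSet A k t S) {ρ : ℕ → ℕ} {v : Fin N} (h0 : ρ 0 = k) (h1 : ρ 1 = v) :
    t.eval A N ρ ≠ 0 ↔ v ∈ S fun j => ρ (10 + j) := by
  rw [ht ρ v h0 h1]
  simp

theorem Computes.top {t h : Term} {f : (ℕ → ℕ) → Fin N → ℕ} (ht : Computes A k t f) {g : ℕ}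
    (hh : ∀ ρ, ρ 0 = k → h.eval A N ρ = g) :
    ComputesSet A k (Term.top h t 1 3) fun x => DenseSubgraph.topSet g (f x) := by
  intro ρ v h0 h1
  rw [eval_top A h t (by norm_num) ρ (f fun j => ρ (10 + j)) (fun ρ' hρ' u hu => ?_) v h1,
    hh ρ h0]
  rw [ht ρ' u (by rw [hρ' 0 (by norm_num) (by norm_num), h0]) hu]
  congr 1
  funext j
  exact hρ' _ (by omega) (by omega)

theorem ComputesSet.or {s t : Term} {S T : (ℕ → ℕ) → Finset (Fin N)} (hs : ComputesSet A k s S)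
    (ht : ComputesSet A k t T) : ComputesSet A k (Term.or s t) fun x => S x ∪ T x := by
  intro ρ v h0 h1
  rw [eval_or, hs ρ v h0 h1, ht ρ v h0 h1]
  simp

/-- The numbers `i` with `2 * i + 1 < k` are exactly those below `k / 2`; `k ≤ N` keeps them in the
range of the sum. -/
theorem eval_half (hk : k ≤ N) (ρ : ℕ → ℕ) (h0 : ρ 0 = k) : half.eval A N ρ = k / 2 := by
  simp only [half, eval, eval_lt, Function.update_self]
  rw [← Finset.card_filter, ← Finset.card_range (k / 2)]
  congr 1
  ext i
  simp only [Finset.mem_filter, Finset.mem_range, h0,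
    Function.update_of_ne (show 0 ≠ 3 by norm_num)]
  omega

variable (G : SimpleGraph (Fin N)) (ω : ℕ → Bool)

/-- Summing `ρ x` over `N` values of variable 2 replaces the missing multiplication; division by `N`
with remainder recovers row and column. -/
theorem eval_adj_ne_zero {x y : ℕ} (hx : x ≠ 2) (v : Fin N) (ρ : ℕ → ℕ) (hy : ρ y = v) :
    (adj x y).eval ((init G k ω).arr 0) N ρ ≠ 0 ↔ ∃ u : Fin N, (u : ℕ) = ρ x ∧ G.Adj u v := by
  have h1 : (adj x y).eval ((init G k ω).arr 0) N ρ = (init G k ω).arr 0 (ρ x * N + v) := by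
    simp [adj, eval, hx, hy, mul_comm]
  rw [h1]
  have : (∃ i j : Fin N, G.Adj i j ∧ ρ x * N + v = (i : ℕ) * N + (j : ℕ)) ↔
      ∃ u : Fin N, (u : ℕ) = ρ x ∧ G.Adj u v := by
    constructor
    · rintro ⟨i, j, hij, h⟩
      have hN : 0 < N := v.pos
      have hd := congrArg (· / N) h
      have hm := congrArg (· % N) h
      simp only [mul_comm _ N, Nat.mul_add_div hN, Nat.mul_add_mod, Nat.div_eq_of_lt v.2,
        Nat.div_eq_of_lt j.2, Nat.mod_eq_of_lt v.2, Nat.mod_eq_of_lt j.2, add_zero] at hd hm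
      exact ⟨i, hd.symm, Fin.ext hm ▸ hij⟩
    · rintro ⟨u, hu, huv⟩
      exact ⟨u, v, huv, by rw [hu]⟩
  simp [init, this]

theorem eval_adj {x y : ℕ} (hx : x ≠ 2) (u v : Fin N) (ρ : ℕ → ℕ) (hxu : ρ x = u)
    (hy : ρ y = v) : (adj x y).eval ((init G k ω).arr 0) N ρ ≠ 0 ↔ G.Adj u v := by
  rw [eval_adj_ne_zero G ω hx v ρ hy, hxu]
  constructor
  · rintro ⟨w, hw, h⟩
    exact Fin.ext hw ▸ h
  · exact fun h => ⟨u, rfl, h⟩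

theorem computesSet_commonNbhd (m : ℕ) :
    ComputesSet ((init G k ω).arr 0) k (commonNbhd m) (DenseSubgraph.commonNbhd G m) := by
  induction m with
  | zero =>
    intro ρ v _ _
    simp [commonNbhd, DenseSubgraph.commonNbhd, eval]
  | succ m ih =>
    intro ρ v h0 h1
    rw [commonNbhd, eval_and]
    refine if_congr ?_ rfl rfl
    rw [eval_adj_ne_zero G ω (by omega) v ρ h1, ih.eval_ne_zero h0 h1]
    simp only [DenseSubgraph.commonNbhd, Finset.mem_filter, Finset.mem_univ, true_and,
      Nat.forall_lt_succ_right]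

theorem ComputesSet.degIn {t : Term} {S : (ℕ → ℕ) → Finset (Fin N)}
    (ht : ComputesSet ((init G k ω).arr 0) k t S) :
    Computes ((init G k ω).arr 0) k (Term.degIn t) fun x => DenseSubgraph.degIn G (S x) := by
  classical
  intro ρ v h0 h1
  simp only [Term.degIn, eval, Finset.sum_range, eval_and, Function.update_self]
  rw [← Finset.card_filter, DenseSubgraph.degIn]
  congr 1
  ext u
  rw [Finset.mem_filter, Finset.mem_filter, ht.eval_ne_zero (v := u) (by simpa using h0) (by simp),
    eval_adj G ω (by norm_num) u v _ (by simp)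
    (by simpa using h1)]
  simp [update_ten_add]

theorem ComputesSet.candidate (hk : k ≤ N) {t : Term} {S : (ℕ → ℕ) → Finset (Fin N)}
    (ht : ComputesSet ((init G k ω).arr 0) k t S) :
    ComputesSet ((init G k ω).arr 0) k (Term.candidate t)
      fun x => DenseSubgraph.candidate G k (S x) := by
  have h1 := (ht.degIn G ω).top (eval_half hk)
  exact (((h1.degIn G ω).top (eval_half hk)).or h1).top fun ρ h0 => h0

theorem ComputesSet.eval_weight {t : Term} {S : (ℕ → ℕ) → Finset (Fin N)}
    (ht : ComputesSet ((init G k ω).arr 0) k t S) (ρ : ℕ → ℕ) (h0 : ρ 0 = k) :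
    (Term.weight t).eval ((init G k ω).arr 0) N ρ =
      DenseSubgraph.weight G (S fun j => ρ (10 + j)) := by
  classical
  simp only [Term.weight, eval, Finset.sum_range, Function.update_self, eval_and]
  rw [DenseSubgraph.weight, ← Fintype.sum_ite_mem (S fun j => ρ (10 + j))]
  refine Finset.sum_congr rfl fun v _ => ?_
  have h1 : ∀ u : Fin N, t.eval ((init G k ω).arr 0) N
      (Function.update (Function.update ρ 1 v) 4 u) ≠ 0 ↔ v ∈ S fun j => ρ (10 + j) := fun u => by
    rw [ht.eval_ne_zero (v := v) (by simpa using h0) (by simp)]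
    simp [update_ten_add]
  have h2 : ∀ u : Fin N, t.eval ((init G k ω).arr 0) N
      (Function.update (Function.update (Function.update ρ 1 v) 4 u) 1 u) ≠ 0 ↔
      u ∈ S fun j => ρ (10 + j) := fun u => by
    rw [ht.eval_ne_zero (v := u) (by simpa using h0) (by simp)]
    simp [update_ten_add]
  have h3 : ∀ u : Fin N, (adj 4 1).eval ((init G k ω).arr 0) N
      (Function.update (Function.update ρ 1 v) 4 u) ≠ 0 ↔ G.Adj u v := fun u =>
    eval_adj G ω (by norm_num) u v _ (by simp) (by simp)
  simp only [h1, h2, h3]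
  by_cases hv : v ∈ S fun j => ρ (10 + j)
  · simp only [hv, true_and, if_true, DenseSubgraph.degIn]
    rw [← Finset.card_filter]
    congr 1
    ext u
    simp
  · simp [hv]

end Computes

end Term

end RAM

/-! ### The program and its guarantee. -/

namespace RAM

/-- A deterministic polynomial time program finds `k` vertices whose number of edges is at least
that of each candidate for a common neighbourhood of `m` vertices. -/
theorem exists_prog_candidate (m : ℕ) : ∃ (p : Prog) (T : Polynomial ℕ),
    ∀ (N k : ℕ) (G : SimpleGraph (Fin N)) (ω : ℕ → Bool), 1 ≤ N → k ≤ N →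
      ∃ n s, Exec p (init G k ω) n s ∧ n ≤ T.eval N ∧ (output N s).card = k ∧
        ∀ x : ℕ → ℕ, (∀ j, x j < N) → DenseSubgraph.weight G (DenseSubgraph.candidate G k
          (DenseSubgraph.commonNbhd G m x)) ≤ DenseSubgraph.weight G (output N s) := by
  set t := Term.candidate (Term.commonNbhd m) with ht
  obtain ⟨p, T, h⟩ := (Term.best t.weight m t).exists_prog_output
  refine ⟨p, T, fun N k G ω hN hk => ?_⟩
  obtain ⟨n, s, e, hn, hs⟩ := h N k G ω
  have hC := (Term.computesSet_commonNbhd (k := k) G ω m).candidate G ω hk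
  obtain ⟨c, hc, hopt⟩ := Term.exists_eval_best ((init G k ω).arr 0) hN k t.weight
    (fun x => DenseSubgraph.weight G (DenseSubgraph.candidate G k
      (DenseSubgraph.commonNbhd G m x)))
    (fun ρ h0 => hC.eval_weight G ω ρ h0) m
  have hout : output N s = DenseSubgraph.candidate G k
      (DenseSubgraph.commonNbhd G m (c fun _ => 0)) := by
    rw [hs]
    ext v
    rw [Finset.mem_filter, hc _ _ (by simp), hC.eval_ne_zero (v := v) (by simp [Term.setTuple])
      (by simp [Term.setTuple])]
    simp [Term.setTuple, Term.update_ten_add]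
  refine ⟨n, s, e, hn, ?_, fun x hx => ?_⟩
  · rw [hout, DenseSubgraph.card_candidate hk]
  · rw [hout]
    -- Optimality compares tuples that agree from `m` on, and the machine starts with zeros there.
    have h1 := hopt (fun _ => 0) (fun j => if j < m then x j else 0)
      (fun j hj => by simpa [hj] using hx j) (fun j hj => by simp [hj])
    have h2 : DenseSubgraph.commonNbhd G m (fun j => if j < m then x j else 0) =
        DenseSubgraph.commonNbhd G m x := by
      ext v
      simp only [DenseSubgraph.commonNbhd, Finset.mem_filter, Finset.mem_univ, true_and]
      refine forall₂_congr fun j hj => ?_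
      simp [hj]
    rwa [h2] at h1

end RAM

/-- The numerical comparison of the bound in terms of `m` with the bound in terms of `γ`. -/
theorem exists_nat_forall_le_rpow {γ : ℝ} (hγ : 0 < γ) : ∃ m : ℕ, 1 ≤ m ∧
    ∀ (N δ : ℝ), 1 ≤ N → (N ^ 2)⁻¹ ≤ δ → δ ≤ 1 →
      δ ^ (11 / γ) * N ^ (-γ) ≤ δ ^ (m + 1) * N ^ (-(1 / m : ℝ)) := by
  refine ⟨⌈1 / γ⌉₊, Nat.ceil_pos.2 (by positivity), fun N δ hN hδN hδ1 => ?_⟩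
  have hN0 : 0 < N := by linarith
  have hδ0 : 0 < δ := lt_of_lt_of_le (by positivity) hδN
  set m := ⌈1 / γ⌉₊ with hm
  have hm1 : (1 : ℝ) ≤ m := by exact_mod_cast Nat.ceil_pos.2 (by positivity)
  -- For `γ ≤ 5`, `m + 1 ≤ 1 / γ + 2 ≤ 11 / γ`. For `γ ≥ 5`, `m = 1` and `11 / γ` may be below 2,
  -- but `δ ≥ N ^ (-2)` gives `δ ^ 2 * N ^ (-1) ≥ N ^ (-5) ≥ N ^ (-γ)`.
  rcases le_total γ 5 with h5 | h5
  · have h1 : (1 / m : ℝ) ≤ γ := by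
      rw [div_le_comm₀ (by linarith) hγ]
      exact Nat.le_ceil _
    have h2 : ((m + 1 : ℕ) : ℝ) ≤ 11 / γ := by
      have := Nat.ceil_lt_add_one (show 0 ≤ 1 / γ by positivity)
      have h3 : 2 ≤ 10 / γ := by
        rw [le_div_iff₀ hγ]
        linarith
      have h4 : 11 / γ = 1 / γ + 10 / γ := by ring
      push_cast
      linarith
    rw [← Real.rpow_natCast δ]
    exact mul_le_mul (Real.rpow_le_rpow_of_exponent_ge hδ0 hδ1 h2)
      (Real.rpow_le_rpow_of_exponent_le hN (by linarith)) (by positivity) (by positivity)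
  · have hm_eq : m = 1 := by
      refine le_antisymm (Nat.ceil_le.2 ?_) (by exact_mod_cast hm1)
      rw [div_le_iff₀ hγ]
      push_cast
      linarith
    have h1 : δ ^ (11 / γ) ≤ 1 := Real.rpow_le_one hδ0.le hδ1 (by positivity)
    have h2 : N ^ (-γ) ≤ N ^ (-5 : ℝ) := Real.rpow_le_rpow_of_exponent_le hN (by linarith)
    have h3 : N ^ (-5 : ℝ) = (N ^ 2)⁻¹ ^ 2 * N ^ (-1 : ℝ) := by
      rw [Real.rpow_neg_one, Real.rpow_neg hN0.le]
      norm_cast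
      field_simp
    calc δ ^ (11 / γ) * N ^ (-γ) ≤ 1 * N ^ (-5 : ℝ) := by gcongr
      _ = (N ^ 2)⁻¹ ^ 2 * N ^ (-1 : ℝ) := by rw [one_mul, h3]
      _ ≤ δ ^ 2 * N ^ (-1 : ℝ) := by gcongr
      _ = _ := by simp [hm_eq]

/-- The output of the algorithm is almost as dense as the densest subgraph. -/
theorem DenseSubgraph.le_density_of_forall_candidate {N k m : ℕ} {G : SimpleGraph (Fin N)}
    {δ γ : ℝ} (hγ : 0 < γ) (hm : 1 ≤ m) (hmγ : ∀ (N δ : ℝ), 1 ≤ N → (N ^ 2)⁻¹ ≤ δ → δ ≤ 1 →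
      δ ^ (11 / γ) * N ^ (-γ) ≤ δ ^ (m + 1) * N ^ (-(1 / m : ℝ)))
    (hk : 1 ≤ k) (hkN : k ≤ N) (hδ : IsDensestDensity G k δ) (S : Finset (Fin N))
    (hS : S.card = k) (hopt : ∀ x : ℕ → ℕ, (∀ j, x j < N) →
      weight G (candidate G k (commonNbhd G m x)) ≤ weight G S) :
    1 / 18 * δ ^ (11 / γ) * (N : ℝ) ^ (-γ) ≤ density (G.induce (S : Set (Fin N))) := by
  obtain ⟨⟨H, hHk, hHδ⟩, -⟩ := hδ
  set T : Finset (Fin N) := H.verts.toFinite.toFinset with hT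
  have hTH : (T : Set (Fin N)) = H.verts := by simp [hT]
  have hTk : T.card = k := by rw [← hHk, ← hTH, Set.ncard_coe_finset]
  have hcard : Nat.card H.verts = k := hHk
  have hSk : density (G.induce (S : Set (Fin N))) = weight G S / (2 * k ^ 2) := by
    have hc : Nat.card (S : Set (Fin N)) = k := by
      rw [Nat.card_coe_set_eq, Set.ncard_coe_finset, hS]
    rw [density, weight_eq_two_mul_ncard_edgeSet_induce, hc]
    push_cast
    rw [mul_div_mul_left _ _ two_ne_zero]
  have hk0 : (0 : ℝ) < k := by exact_mod_cast hk
  have hδk : δ * k ^ 2 = H.coe.edgeSet.ncard := by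
    rw [← hHδ, density, hcard]
    field_simp
  have hTw := two_mul_ncard_edgeSet_le_weight H T hTH
  have hTw' : 2 * (H.coe.edgeSet.ncard : ℝ) ≤ weight G T := by exact_mod_cast hTw
  -- Without edges the bound is zero. With an edge, `δ ≥ 1 / k ^ 2 ≥ 1 / N ^ 2` and `k ≥ 2`.
  rcases Nat.eq_zero_or_pos H.coe.edgeSet.ncard with h0 | hpos
  · have : δ = 0 := by
      rw [← hHδ, density, h0]
      simp
    rw [this, Real.zero_rpow (by positivity), hSk]
    simp only [mul_zero, zero_mul]
    positivity
  have hpos' : (1 : ℝ) ≤ H.coe.edgeSet.ncard := by exact_mod_cast hpos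
  have hN1 : (1 : ℝ) ≤ N := by exact_mod_cast hk.trans hkN
  have hδN : ((N : ℝ) ^ 2)⁻¹ ≤ δ := by
    have hkN' : (k : ℝ) ≤ N := by exact_mod_cast hkN
    rw [inv_le_iff_one_le_mul₀ (by positivity)]
    have : 0 ≤ δ := by
      rw [← hHδ, density]
      positivity
    calc 1 ≤ δ * k ^ 2 := by rwa [hδk]
      _ ≤ _ := by gcongr
  have hδ0 : 0 ≤ δ := le_trans (by positivity) hδN
  have hTle : (weight G T : ℝ) ≤ k ^ 2 := by
    have : weight G T ≤ ∑ v ∈ T, k := Finset.sum_le_sum fun v _ => hTk ▸ degIn_le_card T v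
    have h2 : weight G T ≤ k ^ 2 := by simpa [hTk, sq] using this
    exact_mod_cast h2
  have hδ2 : δ ≤ 1 / 2 := by
    have : δ * k ^ 2 ≤ 1 / 2 * k ^ 2 := by linarith
    exact le_of_mul_le_mul_right this (by positivity)
  have hk2 : 2 ≤ k := by
    by_contra hlt
    obtain rfl : k = 1 := by omega
    rw [Nat.cast_one, one_pow, mul_one] at hδk
    linarith
  have h1 := le_weight_candidate hm hk2 hkN hopt T hTk hδ0 hδ2 (by linarith)
  have h2 := hmγ N δ hN1 hδN (by linarith)
  rw [hSk, le_div_iff₀ (by positivity)]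
  have h3 := mul_le_mul_of_nonneg_right h2 (by positivity : (0 : ℝ) ≤ k ^ 2)
  linarith

theorem corollary4 :
    ∃ K : ℝ, 0 < K ∧
      ∀ γ : ℝ, 0 < γ → ∃ c : ℝ, 0 < c ∧
        ∀ d : ℕ, ∃ (p : RAM.Prog) (T : Polynomial ℕ),
          ∀ (N k : ℕ) (G : SimpleGraph (Fin N)) (δ : ℝ), 1 ≤ k → k ≤ N →
            DenseSubgraph.IsDensestDensity G k δ →
            (∀ ω : ℕ → Bool, ∃ (t : ℕ) (s : RAM.State),
              RAM.Exec p (RAM.init G k ω) t s ∧ t ≤ T.eval N ∧ (RAM.output N s).card = k) ∧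
            1 - 1 / (N : ℝ) ^ d ≤
              RAM.coinMeasure.real {ω : ℕ → Bool | ∃ (t : ℕ) (s : RAM.State),
                RAM.Exec p (RAM.init G k ω) t s ∧
                c * δ ^ (K / γ) * (N : ℝ) ^ (-γ) ≤
                  DenseSubgraph.density (G.induce (RAM.output N s : Set (Fin N)))} := by
  -- `18 = 2 * 9`: the greedy loss 9, and 2 because `weight` counts each edge twice.
  refine ⟨11, by norm_num, fun γ hγ => ⟨1 / 18, by norm_num, fun d => ?_⟩⟩
  obtain ⟨m, hm, hmγ⟩ := exists_nat_forall_le_rpow hγ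
  obtain ⟨p, T, h⟩ := RAM.exists_prog_candidate m
  refine ⟨p, T, fun N k G δ hk hkN hδ => ⟨fun ω => ?_, ?_⟩⟩
  · obtain ⟨n, s, e, hn, hs, -⟩ := h N k G ω (hk.trans hkN) hkN
    exact ⟨n, s, e, hn, hs⟩
  · have huniv : {ω : ℕ → Bool | ∃ (t : ℕ) (s : RAM.State), RAM.Exec p (RAM.init G k ω) t s ∧
        1 / 18 * δ ^ (11 / γ) * (N : ℝ) ^ (-γ) ≤
          DenseSubgraph.density (G.induce (RAM.output N s : Set (Fin N)))} = Set.univ := by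
      refine Set.eq_univ_of_forall fun ω => ?_
      obtain ⟨n, s, e, -, hs, hopt⟩ := h N k G ω (hk.trans hkN) hkN
      exact ⟨n, s, e, DenseSubgraph.le_density_of_forall_candidate hγ hm hmγ hk hkN hδ _ hs hopt⟩
    have : IsProbabilityMeasure RAM.coinMeasure := by
      unfold RAM.coinMeasure
      infer_instance
    rw [huniv, probReal_univ]
    have : 0 ≤ 1 / (N : ℝ) ^ d := by positivity
    linarith
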